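/- **Setting.** Let $f:\mathcal X\to\mathcal O$ be a deployed model, $\ell:\mathcal O\times\mathcal Y\to[0,1]$ a loss, and let $f_{\mathrm p}:\mathcal X\to\mathcal Y$ assign synthetic labels to inputs (for instance the most likely class of an auxiliary classifier); all maps are measurable. Write $\tilde\ell(x)=\ell(f(x),f_{\mathrm p}(x))$. Let $P_0$ be the source distribution and $P_1,P_2,\dots$ the test distributions on $\mathcal X\times\mathcal Y$. At each time $t\ge 0$ one observes $n_t\ge1$ labeled samples $(x_{t,i},y_{t,i})\sim P_t$, $1\le i\le n_t$, and $N_t\ge 1$ unlabeled inputs $\tilde x_{t,j}$, $1\le j\le N_t$, drawn from the input marginal of $P_t$. All these samples, of all times, are mutually independent, and $n_0$ divides $N_0$. Put $R_t=\mathbb E_{(x,y)\sim P_t}[\ell(f(x),y)]$ and $\bar R_t=\frac1t\sum_{s=1}^tR_s$. For $\epsilon_{\mathrm{tol}}>0$ the null hypothesis $\mathcal H_0$ is: $\bar R_t\le R_0+\epsilon_{\mathrm{tol}}$ for all $t\ge1$. **Source bound.** Fix $\delta_{\mathrm S}\in(0,1)$ and a constant $\eta_0\ge0$, let $b=N_0/n_0$,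 and for $1\le i\le n_0$ put $$z_i=\frac{\eta_0}{b}\sum_{j=(i-1)b+1}^{ib}\tilde\ell(\tilde x_{0,j})+\ell(f(x_{0,i}),y_{0,i})-\eta_0\,\tilde\ell(x_{0,i})\in[-\eta_0,1+\eta_0],\qquad z_i'=\frac{z_i+\eta_0}{1+2\eta_0}\in[0,1].$$ Take any betting strategy: stakes $\nu_k(m)=\nu_k(m;z'_1,\dots,z'_{k-1})\ge0$, measurable in the past observations, with $\nu_k(m)(1-m)\le1$ for $m\in[0,1]$. With $K_i(m)=\prod_{k\le i}\bigl(1-\nu_k(m)(z'_k-m)\bigr)$, set $$U_0^{\mathrm{PP}}=(1+2\eta_0)\,\sup\{m\in[0,1]: K_i(m)<1/\delta_{\mathrm S}\ \text{for all } i\le n_0\}-\eta_0 .$$ **Test bound.** Let $\{\eta_t\}_{t\ge1}$ be any predictable sequence of reliance weights with values in $[0,\eta_{\max}]$, i.e. each $\eta_t$ is a measurable function of the test data of times $1,\dots,t-1$. For $t\ge1$ put $$\hat R_t^{\mathrm{PP}}=\frac{\eta_t}{N_t}\sum_{j=1}^{N_t}\tilde\ell(\tilde x_{t,j})+\frac1{n_t}\sum_{i=1}^{n_t}\ell(f(x_{t,i}),y_{t,i})-\frac{\eta_t}{n_t}\sum_{i=1}^{n_t}\tilde\ell(x_{t,i}),\qquad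 \hat{\bar R}_t^{\mathrm{PP}}=\frac1t\sum_{s=1}^t\hat R_s^{\mathrm{PP}},$$ and let $\hat{\bar R}_0^{\mathrm{PP}}$ be any measurable function of the source data with values in $[-\eta_{\max},1+\eta_{\max}]$. With $g(r)=(r+\eta_{\max})/(1+2\eta_{\max})$ put $V_t=\sum_{s=1}^t\bigl(g(\hat R_s^{\mathrm{PP}})-g(\hat{\bar R}_{s-1}^{\mathrm{PP}})\bigr)^2$. For $\delta_{\mathrm T}\in(0,1)$, any probability distribution $q$ on $(0,1)$ (in particular any with a density) and $\psi_E(\lambda)=-\log(1-\lambda)-\lambda$, let $$u(V)=\sup\Bigl\{S\in\mathbb R:\int_0^1 e^{\lambda S-\psi_E(\lambda)V}\,q(\mathrm d\lambda)<1/\delta_{\mathrm T}\Bigr\},\qquad L_t^{\mathrm{PP}}=\hat{\bar R}_t^{\mathrm{PP}}-(1+2\eta_{\max})\,\frac{u(V_t)}{t}.$$ **Theorem (PFA guarantee of PPRM).** Let $\delta_{\mathrm S},\delta_{\mathrm T}\in(0,1)$ with $\delta_{\mathrm S}+\delta_{\mathrm T}\in(0,1)$, and let $\Phi_t^{\mathrm{PP}}=\mathbb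 1[L_t^{\mathrm{PP}}>U_0^{\mathrm{PP}}+\epsilon_{\mathrm{tol}}]$. For every sequence of distributions satisfying $\mathcal H_0$, $$\mathbb P\bigl(\exists\,t\ge1:\ \Phi_t^{\mathrm{PP}}=1\bigr)\le\delta_{\mathrm S}+\delta_{\mathrm T}.$$ -/

import Mathlib

open MeasureTheory ProbabilityTheory

noncomputable section

namespace PPRM

section Losses

variable {X Y O : Type*}

/-- Loss of the deployed model `f` on a labeled example `(x, y)`. -/
def trueLoss (f : X → O) (loss : O → Y → ℝ) (z : X × Y) : ℝ := loss (f z.1) z.2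

/-- Loss of the deployed model `f` on the input `x` with the synthetic label `fp x`. -/
def synthLoss (f : X → O) (loss : O → Y → ℝ) (fp : X → Y) (x : X) : ℝ := loss (f x) (fp x)

/-- The risk `R = E[loss (f x) y]` for `(x, y) ∼ P`. -/
def risk [MeasurableSpace X] [MeasurableSpace Y] (f : X → O) (loss : O → Y → ℝ)
    (P : Measure (X × Y)) : ℝ := ∫ z, trueLoss f loss z ∂P

/-- The running test risk `(1/t) ∑_{s=1}^t R_s`. -/
def runningRisk [MeasurableSpace X] [MeasurableSpace Y] (f : X → O) (loss : O → Y → ℝ)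
    (P : ℕ → Measure (X × Y)) (t : ℕ) : ℝ :=
  (∑ s ∈ Finset.Icc 1 t, risk f loss (P s)) / t

/-- The null hypothesis: the running test risk never exceeds the source risk by more than the
tolerance. -/
def NullHypothesis [MeasurableSpace X] [MeasurableSpace Y] (f : X → O) (loss : O → Y → ℝ)
    (P : ℕ → Measure (X × Y)) (tol : ℝ) : Prop :=
  ∀ t : ℕ, 1 ≤ t → runningRisk f loss P t ≤ risk f loss (P 0) + tol

/-- The prediction-powered risk estimate with reliance weight `η`, from a labeled batch `D` and
an unlabeled batch `U`. -/
def ppEstimate (f : X → O) (loss : O → Y → ℝ) (fp : X → Y) {n N : ℕ}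
    (D : Fin n → X × Y) (U : Fin N → X) (η : ℝ) : ℝ :=
  η / N * ∑ j, synthLoss f loss fp (U j)
    + (1 / n * ∑ i, trueLoss f loss (D i) - η / n * ∑ i, synthLoss f loss fp (D i).1)

/-- Per-sample source estimate: the `N` unlabeled inputs are split into `n` consecutive blocks of
`N / n` inputs, and the `i`-th labeled sample is paired with the `i`-th block. -/
def blockEstimate (f : X → O) (loss : O → Y → ℝ) (fp : X → Y) {n N : ℕ}
    (D : Fin n → X × Y) (U : Fin N → X) (η : ℝ) (i : Fin n) : ℝ :=
  (n : ℝ) / N * ∑ j ∈ Finset.univ.filter (fun j : Fin N => (j : ℕ) / (N / n) = (i : ℕ)),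
      η * synthLoss f loss fp (U j)
    + trueLoss f loss (D i) - η * synthLoss f loss fp (D i).1

end Losses

/-- The affine map that sends `[-a, 1 + a]` onto `[0, 1]`. -/
def normalize (a x : ℝ) : ℝ := (x + a) / (1 + 2 * a)

/-! ### Betting upper confidence bound for the mean of `[0,1]`-valued data -/

/-- A one-sided predictable betting strategy. `bet m k h` is the stake placed, against the
candidate mean `m`, on observation number `k` (counted from `0`) once the first `k` observations
`h` have been seen; stakes are such that the capital cannot become negative. -/
structure IsBettingStrategy (bet : ℝ → (k : ℕ) → (Fin k → ℝ) → ℝ) : Prop where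
  measurable : ∀ m ∈ Set.Icc (0 : ℝ) 1, ∀ k, Measurable (bet m k)
  nonneg : ∀ m ∈ Set.Icc (0 : ℝ) 1, ∀ k h, 0 ≤ bet m k h
  mul_le_one : ∀ m ∈ Set.Icc (0 : ℝ) 1, ∀ k h, bet m k h * (1 - m) ≤ 1

/-- The capital `∏_{k < i} (1 - ν_k(m) (x_k - m))` after `i` rounds. -/
def capital (bet : ℝ → (k : ℕ) → (Fin k → ℝ) → ℝ) {n : ℕ} (x : Fin n → ℝ) (m : ℝ) (i : ℕ) : ℝ :=
  ∏ k ∈ Finset.univ.filter (fun k : Fin n => (k : ℕ) < i),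
    (1 - bet m k (fun j : Fin k => x (Fin.castLE k.isLt.le j)) * (x k - m))

/-- The betting upper bound: the largest candidate mean in `[0,1]` against which the capital
stays below `1/δ` throughout. -/
def bettingUpper (δ : ℝ) (bet : ℝ → (k : ℕ) → (Fin k → ℝ) → ℝ) {n : ℕ} (x : Fin n → ℝ) : ℝ :=
  sSup {m : ℝ | m ∈ Set.Icc (0 : ℝ) 1 ∧ ∀ i ≤ n, capital bet x m i < 1 / δ}

/-- The source upper bound: the betting bound on the per-sample source estimates (which lie in
`[-η₀, 1 + η₀]`), rescaled to `[0,1]` and back. -/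
def sourceUpper {X Y O : Type*} (f : X → O) (loss : O → Y → ℝ) (fp : X → Y)
    (δ : ℝ) (bet : ℝ → (k : ℕ) → (Fin k → ℝ) → ℝ) {n N : ℕ}
    (D : Fin n → X × Y) (U : Fin N → X) (η₀ : ℝ) : ℝ :=
  (1 + 2 * η₀) * bettingUpper δ bet (fun i => normalize η₀ (blockEstimate f loss fp D U η₀ i)) - η₀

/-! ### Conjugate-mixture empirical-Bernstein lower confidence sequence -/

/-- `ψ_E(l) = -log (1 - l) - l`. -/
def psiE (l : ℝ) : ℝ := -Real.log (1 - l) - l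

/-- The mixture boundary
`u(V) = sup {S : ∫_0^1 exp (l S - ψ_E(l) V) q(dl) < 1/δ}` for a mixing distribution `q`. -/
def mixtureBoundary (q : Measure ℝ) (δ V : ℝ) : ℝ :=
  sSup {S : ℝ | ∫ l in Set.Ioo (0 : ℝ) 1, Real.exp (l * S - psiE l * V) ∂q < 1 / δ}

/-- Running average of the estimates `e 1, …, e t`; the value `r₀` is used at time `0`. -/
def runningEstimate (r₀ : ℝ) (e : ℕ → ℝ) (t : ℕ) : ℝ :=
  if t = 0 then r₀ else (∑ s ∈ Finset.Icc 1 t, e s) / t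

/-- Cumulative squared error of the rescaled estimates when each one is predicted by the rescaled
running average of its predecessors. -/
def predictionError (ηmax r₀ : ℝ) (e : ℕ → ℝ) (t : ℕ) : ℝ :=
  ∑ s ∈ Finset.Icc 1 t, (normalize ηmax (e s) - normalize ηmax (runningEstimate r₀ e (s - 1))) ^ 2

/-- The lower bound on the running risk at time `t`; the width `u(V_t)/t`, which is valid for the
rescaled estimates, is multiplied by `1 + 2 ηmax` to return to the scale of the loss. -/
def testLower (ηmax : ℝ) (q : Measure ℝ) (δ r₀ : ℝ) (e : ℕ → ℝ) (t : ℕ) : ℝ :=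
  runningEstimate r₀ e t
    - (1 + 2 * ηmax) * (mixtureBoundary q δ (predictionError ηmax r₀ e t) / t)

/-! ### Data -/

section Data

variable {Ω X Y : Type*} [MeasurableSpace X] [MeasurableSpace Y] {n N : ℕ → ℕ}

/-- The σ-algebra generated by the labeled and unlabeled batches of time `t`. -/
abbrev batchSigma (D : (t : ℕ) → Fin (n t) → Ω → X × Y) (U : (t : ℕ) → Fin (N t) → Ω → X) (t : ℕ) :
    MeasurableSpace Ω :=
  (⨆ i, MeasurableSpace.comap (D t i) inferInstance)
    ⊔ ⨆ j, MeasurableSpace.comap (U t j) inferInstance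

/-- The σ-algebra generated by the test data of times `1, …, t - 1`. -/
abbrev pastSigma (D : (t : ℕ) → Fin (n t) → Ω → X × Y) (U : (t : ℕ) → Fin (N t) → Ω → X) (t : ℕ) :
    MeasurableSpace Ω :=
  ⨆ s ∈ Finset.Ico 1 t, batchSigma D U s

/-- Source data (time `0`) and test data (times `t ≥ 1`): all labeled samples and all unlabeled
inputs, of all times, are mutually independent, the labeled samples of time `t` have law `P t`,
and the unlabeled inputs of time `t` have the input marginal of `P t` as their law. -/
structure IsDataStream [MeasurableSpace Ω] (μ : Measure Ω) (P : ℕ → Measure (X × Y))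
    (D : (t : ℕ) → Fin (n t) → Ω → X × Y) (U : (t : ℕ) → Fin (N t) → Ω → X) : Prop where
  measurable_labeled : ∀ t i, Measurable (D t i)
  measurable_unlabeled : ∀ t j, Measurable (U t j)
  law_labeled : ∀ t i, μ.map (D t i) = P t
  law_unlabeled : ∀ t j, μ.map (U t j) = (P t).map Prod.fst
  indep : iIndep (fun k : (Σ t : ℕ, Fin (n t) ⊕ Fin (N t)) =>
    Sum.elim (fun i => MeasurableSpace.comap (D k.1 i) inferInstance)
      (fun j => MeasurableSpace.comap (U k.1 j) inferInstance) k.2) μ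

end Data

open Classical in
/-- The alarm `Φ_t = 1[L_t > U_0 + tol]` on the sample path `ω`. -/
def alarm {Ω X Y O : Type*} (f : X → O) (loss : O → Y → ℝ) (fp : X → Y) {n N : ℕ → ℕ}
    (D : (t : ℕ) → Fin (n t) → Ω → X × Y) (U : (t : ℕ) → Fin (N t) → Ω → X)
    (δS δT tol : ℝ) (η₀ : ℝ) (bet : ℝ → (k : ℕ) → (Fin k → ℝ) → ℝ)
    (ηmax : ℝ) (η : ℕ → Ω → ℝ) (q : Measure ℝ) (r₀ : Ω → ℝ) (t : ℕ) (ω : Ω) : ℕ :=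
  if testLower ηmax q δT (r₀ ω)
        (fun s => ppEstimate f loss fp (fun i => D s i ω) (fun j => U s j ω) (η s ω)) t
      > sourceUpper f loss fp δS bet (fun i => D 0 i ω) (fun j => U 0 j ω) η₀ + tol
  then 1 else 0

end PPRM

end

/-!
Under the null hypothesis an alarm needs the failure of one of two confidence bounds: an alarm
at time `t` means that the source upper bound is below the source risk or that the test lower
bound is above the running test risk. The two failures have probability at most `δS` and `δT`.

Both bounds invert a test by betting. A capital process starts at `1`, and its multiplier in each
round has mean at most `1` given the past, so by Ville's inequality (`ville`) it ever reaches
`1 / δ` with probability at most `δ`. `mixture_capital_crossing` is this statement for a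
mixture of capital processes driven by independent batches of data. The past and the new data of a round are both
represented by the sample point, read through two independent σ-algebras, so a conditional mean
becomes an integral over the new data with the past frozen, and integrals take values in `[0, ∞]`,
which makes integrability of the capital irrelevant.

* Source (`measure_bettingUpper_lt_mean_le`): against the true mean the betting multipliers have
  mean `1`. The block estimates are independent because sample `k` and block `k` form round `k`,
  and unbiased because each is a prediction-powered estimate (`exists_blockEstimate_eq_ppEstimate`,
  `integral_ppEstimate`).
* Test (`measure_mixtureBoundary_lt_le`): for an observation `X` with mean `m` and a prediction `p`,
  all in `[0, 1]`, Fan's inequality (`exp_mul_sub_psiE_le`) bounds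
  `exp (l (X - p) - ψ_E(l) (X - p) ^ 2)` by `1 + l (X - p)`, whose mean is at most
  `exp (l (m - p))`. Hence `exp (l (X - m) - ψ_E(l) (X - p) ^ 2)` has mean at most `1`. The
  mixture over `l` of the products of these multipliers is at least `1 / δ` whenever the centred sum exceeds the mixture
  boundary.
-/

namespace PPRM

open scoped ENNReal

/-! ### Ville's inequality -/

/-- Ville's inequality for a process with values in `[0, ∞]`, with the supermartingale property
stated as a comparison of integrals over past events, so that no integrability is needed. -/
theorem ville {Ω : Type*} {mΩ : MeasurableSpace Ω} {μ : Measure Ω}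
    {ℱ : ℕ → MeasurableSpace Ω} (hmono : Monotone ℱ) (hle : ∀ t, ℱ t ≤ mΩ)
    {M : ℕ → Ω → ℝ≥0∞} (hM : ∀ t, Measurable[ℱ t] (M t))
    (hstep : ∀ t A, MeasurableSet[ℱ t] A → ∫⁻ ω in A, M (t + 1) ω ∂μ ≤ ∫⁻ ω in A, M t ω ∂μ)
    (hM0 : ∫⁻ ω, M 0 ω ∂μ ≤ 1) (c : ℝ≥0∞) :
    c * μ {ω | ∃ t, c ≤ M t ω} ≤ 1 := by
  set E : ℕ → Set Ω := fun t => {ω | ∃ s ≤ t, c ≤ M s ω} with hE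
  have hEmeas : ∀ t, MeasurableSet[ℱ t] (E t) := by
    intro t
    have : E t = ⋃ s ∈ Set.Iic t, {ω | c ≤ M s ω} := by
      ext ω; simp [hE]
    rw [this]
    refine MeasurableSet.biUnion (Set.to_countable _) fun s hs => ?_
    exact hmono hs _ (hM s measurableSet_Ici)
  have hEmono : Monotone E := fun s t hst ω ⟨r, hr, h⟩ => ⟨r, hr.trans hst, h⟩
  -- Capital stopped at the first crossing of `c` has integral at most `1`.
  have key : ∀ t, c * μ (E t) + ∫⁻ ω in (E t)ᶜ, M t ω ∂μ ≤ 1 := by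
    intro t
    induction t with
    | zero =>
      have h1 : c * μ (E 0) ≤ ∫⁻ ω in E 0, M 0 ω ∂μ := by
        rw [← setLIntegral_const]
        refine setLIntegral_mono' (hle _ _ (hEmeas 0)) ?_
        rintro ω ⟨s, hs, h⟩
        obtain rfl : s = 0 := by omega
        exact h
      calc _ ≤ ∫⁻ ω in E 0, M 0 ω ∂μ + ∫⁻ ω in (E 0)ᶜ, M 0 ω ∂μ := by gcongr
        _ = ∫⁻ ω, M 0 ω ∂μ := lintegral_add_compl _ (hle _ _ (hEmeas 0))
        _ ≤ 1 := hM0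
    | succ t ih =>
      have hEt := hle _ _ (hEmeas t)
      have hEt1 := hle _ _ (hEmeas (t + 1))
      have hsub : E t ⊆ E (t + 1) := hEmono (Nat.le_succ t)
      have h1 : c * μ (E (t + 1) \ E t) ≤ ∫⁻ ω in E (t + 1) \ E t, M (t + 1) ω ∂μ := by
        rw [← setLIntegral_const]
        refine setLIntegral_mono' (hEt1.diff hEt) ?_
        rintro ω ⟨⟨s, hs, h⟩, hn⟩
        obtain rfl : s = t + 1 := by
          by_contra hne
          exact hn ⟨s, by omega, h⟩
        exact h
      have h2 : μ (E (t + 1)) = μ (E t) + μ (E (t + 1) \ E t) := by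
        rw [← measure_union disjoint_sdiff_self_right (hEt1.diff hEt),
          Set.union_sdiff_cancel hsub]
      have h3 : ∫⁻ ω in (E t)ᶜ, M (t + 1) ω ∂μ
          = ∫⁻ ω in E (t + 1) \ E t, M (t + 1) ω ∂μ + ∫⁻ ω in (E (t + 1))ᶜ, M (t + 1) ω ∂μ := by
        have : (E t)ᶜ = (E (t + 1) \ E t) ∪ (E (t + 1))ᶜ := by
          ext ω
          have := @hsub ω
          simp only [Set.mem_compl_iff, Set.mem_union, Set.mem_sdiff]
          tauto
        rw [this, lintegral_union hEt1.compl]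
        exact Set.disjoint_left.2 fun ω h h' => h' h.1
      calc c * μ (E (t + 1)) + ∫⁻ ω in (E (t + 1))ᶜ, M (t + 1) ω ∂μ
          = c * μ (E t) + (c * μ (E (t + 1) \ E t)
              + ∫⁻ ω in (E (t + 1))ᶜ, M (t + 1) ω ∂μ) := by rw [h2, mul_add, add_assoc]
        _ ≤ c * μ (E t) + ∫⁻ ω in (E t)ᶜ, M (t + 1) ω ∂μ := by rw [h3]; gcongr
        _ ≤ c * μ (E t) + ∫⁻ ω in (E t)ᶜ, M t ω ∂μ := by
            gcongr 1; exact hstep t _ (hEmeas t).compl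
        _ ≤ 1 := ih
  have hU : {ω | ∃ t, c ≤ M t ω} = ⋃ t, E t := by
    ext ω
    simp only [Set.mem_ofPred_eq, Set.mem_iUnion, hE]
    exact ⟨fun ⟨t, h⟩ => ⟨t, t, le_rfl, h⟩, fun ⟨t, s, _, h⟩ => ⟨s, h⟩⟩
  rw [hU, hEmono.measure_iUnion, ENNReal.mul_iSup]
  exact iSup_le fun t => le_self_add.trans (key t)

/-! ### Mixtures of capital processes driven by independent data -/

theorem lintegral_mul_le_of_indepFun {Ω α β : Type*} {mΩ : MeasurableSpace Ω}
    {mα : MeasurableSpace α} {mβ : MeasurableSpace β} {μ : Measure Ω} [IsProbabilityMeasure μ]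
    {X : Ω → α} {Y : Ω → β} (hX : Measurable X) (hY : Measurable Y) (hind : IndepFun X Y μ)
    {H : α → ℝ≥0∞} (hH : Measurable H) {Φ : α → β → ℝ≥0∞}
    (hΦ : Measurable (Function.uncurry Φ)) (hle : ∀ a, ∫⁻ ω, Φ a (Y ω) ∂μ ≤ 1) :
    ∫⁻ ω, H (X ω) * Φ (X ω) (Y ω) ∂μ ≤ ∫⁻ ω, H (X ω) ∂μ := by
  have hmap := (indepFun_iff_map_prod_eq_prod_map_map hX.aemeasurable hY.aemeasurable).1 hind
  have : IsProbabilityMeasure (μ.map Y) := Measure.isProbabilityMeasure_map hY.aemeasurable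
  have hm : Measurable fun p : α × β => H p.1 * Φ p.1 p.2 := (hH.comp measurable_fst).mul hΦ
  calc ∫⁻ ω, H (X ω) * Φ (X ω) (Y ω) ∂μ
      = ∫⁻ p, H p.1 * Φ p.1 p.2 ∂(μ.map fun ω => (X ω, Y ω)) :=
        (lintegral_map hm (hX.prodMk hY)).symm
    _ = ∫⁻ a, ∫⁻ b, H a * Φ a b ∂(μ.map Y) ∂(μ.map X) := by
        rw [hmap, lintegral_prod _ hm.aemeasurable]
    _ ≤ ∫⁻ a, H a ∂(μ.map X) := by
        refine lintegral_mono fun a => ?_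
        have hΦa : Measurable (Φ a) := hΦ.comp measurable_prodMk_left
        rw [lintegral_const_mul _ hΦa, lintegral_map hΦa hY]
        exact (mul_le_mul_right (hle a) _).trans_eq (mul_one _)
    _ = ∫⁻ ω, H (X ω) ∂μ := lintegral_map hH hX

/-- One betting round: if the σ-algebras `m₁` (past) and `m₂` (new data) are independent and the
multiplier `Φ a b`, with the past frozen at `a`, has integral at most `1` over the new data `b`,
then multiplying a past quantity by `Φ` does not increase its integral. Both data are represented
by the sample point itself, read through `m₁` and through `m₂`. -/
theorem lintegral_mul_le_of_indep {Ω : Type*} {m₁ m₂ mΩ : MeasurableSpace Ω} {μ : Measure Ω}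
    [IsProbabilityMeasure μ] (h₁ : m₁ ≤ mΩ) (h₂ : m₂ ≤ mΩ) (hind : Indep m₁ m₂ μ)
    {H : Ω → ℝ≥0∞} (hH : Measurable[m₁] H) {Φ : Ω → Ω → ℝ≥0∞}
    (hΦ : Measurable[m₁.prod m₂] (Function.uncurry Φ)) (hle : ∀ a, ∫⁻ b, Φ a b ∂μ ≤ 1) :
    ∫⁻ ω, H ω * Φ ω ω ∂μ ≤ ∫⁻ ω, H ω ∂μ := by
  refine @lintegral_mul_le_of_indepFun Ω Ω Ω mΩ m₁ m₂ μ _ id id (measurable_id'' h₁)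
    (measurable_id'' h₂) ?_ H hH Φ hΦ hle
  refine (@IndepFun_iff_Indep Ω Ω Ω mΩ m₁ m₂ id id μ).2 ?_
  simpa only [MeasurableSpace.comap_id] using hind

/-- Crossing bound for a `q`-mixture of capital processes. The σ-algebra `𝒢 t` of the data of
round `t` is independent of the earlier ones, and `F t l a b` is the multiplier of round `t` in
the component `l` when the past is `a` and the new data are `b`. -/
theorem mixture_capital_crossing {Ω Λ : Type*} {mΛ : MeasurableSpace Λ} {mΩ : MeasurableSpace Ω}
    {μ : Measure Ω} [IsProbabilityMeasure μ] {q : Measure Λ} [SFinite q] (hq : q Set.univ ≤ 1)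
    {𝒢 : ℕ → MeasurableSpace Ω} (hle : ∀ t, 𝒢 t ≤ mΩ)
    (hind : ∀ t, Indep (⨆ s ∈ Set.Iio t, 𝒢 s) (𝒢 t) μ)
    {F : ℕ → Λ → Ω → Ω → ℝ≥0∞}
    (hF : ∀ t, Measurable[mΛ.prod ((⨆ s ∈ Set.Iio t, 𝒢 s).prod (𝒢 t))]
      fun p : Λ × Ω × Ω => F t p.1 p.2.1 p.2.2)
    (hF1 : ∀ t, ∀ᵐ l ∂q, ∀ a, ∫⁻ b, F t l a b ∂μ ≤ 1) (c : ℝ≥0∞) :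
    c * μ {ω | ∃ t, c ≤ ∫⁻ l, ∏ s ∈ Finset.range t, F s l ω ω ∂q} ≤ 1 := by
  set ℱ : ℕ → MeasurableSpace Ω := fun t => ⨆ s ∈ Set.Iio t, 𝒢 s with hℱ
  have hmono : Monotone ℱ := fun s t hst =>
    biSup_mono fun r (hr : r < s) => lt_of_lt_of_le hr hst
  have hℱle : ∀ t, ℱ t ≤ mΩ := fun t => iSup₂_le fun s _ => hle s
  have h𝒢ℱ : ∀ s t, s < t → 𝒢 s ≤ ℱ t := fun s t h => le_iSup₂_of_le s h le_rfl
  have hprod : ∀ t, Measurable[mΛ.prod (ℱ t)]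
      fun p : Λ × Ω => ∏ s ∈ Finset.range t, F s p.1 p.2 p.2 := by
    intro t
    let : MeasurableSpace Ω := ℱ t
    refine Finset.measurable_fun_prod _ fun s hs => ?_
    have hst := Finset.mem_range.1 hs
    refine (hF s).comp (f := fun p : Λ × Ω => (p.1, p.2, p.2)) ?_
    refine measurable_fst.prodMk (Measurable.prodMk ?_ ?_)
    · exact measurable_snd.mono le_rfl (hmono hst.le)
    · exact measurable_snd.mono le_rfl (h𝒢ℱ s t hst)
  have hprod' : ∀ t, Measurable fun p : Λ × Ω => ∏ s ∈ Finset.range t, F s p.1 p.2 p.2 :=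
    fun t => (hprod t).mono (sup_le_sup le_rfl (MeasurableSpace.comap_mono (hℱle t))) le_rfl
  refine ville (ℱ := ℱ) hmono hℱle (fun t => ?_) (fun t A hA => ?_) ?_ c
  · exact @Measurable.lintegral_prod_left' _ _ _ (ℱ t) q _ _ (hprod t)
  · have swap : ∀ t, ∫⁻ ω in A, ∫⁻ l, ∏ s ∈ Finset.range t, F s l ω ω ∂q ∂μ
        = ∫⁻ l, ∫⁻ ω in A, ∏ s ∈ Finset.range t, F s l ω ω ∂μ ∂q := fun t =>
      lintegral_lintegral_swap ((hprod' t).comp measurable_swap).aemeasurable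
    rw [swap, swap]
    refine lintegral_mono_ae ((hF1 t).mono fun l hl => ?_)
    have hA' := hℱle t _ hA
    rw [← lintegral_indicator hA', ← lintegral_indicator hA']
    have hH : Measurable[ℱ t]
        (A.indicator fun ω => ∏ s ∈ Finset.range t, F s l ω ω) := by
      have h := (hprod t).comp (@measurable_prodMk_left _ _ _ (ℱ t) l)
      exact Measurable.indicator h hA
    have hΦ : Measurable[(ℱ t).prod (𝒢 t)] (Function.uncurry (F t l)) :=
      (hF t).comp (@measurable_prodMk_left _ _ _ ((ℱ t).prod (𝒢 t)) l)
    refine le_trans (le_of_eq (lintegral_congr fun ω => ?_))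
      (lintegral_mul_le_of_indep (hℱle t) (hle t) (hind t) hH hΦ hl)
    by_cases h : ω ∈ A <;> simp [h, Finset.prod_range_succ]
  · simpa using hq

/-- Disjoint groups of independent σ-algebras: each group is independent of the earlier ones. -/
theorem indep_biSup_Iio {Ω ι : Type*} {mΩ : MeasurableSpace Ω} {μ : Measure Ω}
    {m : ι → MeasurableSpace Ω} (hle : ∀ i, m i ≤ mΩ) (hm : iIndep m μ) {S : ℕ → Set ι}
    (hS : Pairwise fun s t => Disjoint (S s) (S t)) (t : ℕ) :
    Indep (⨆ s ∈ Set.Iio t, ⨆ k ∈ S s, m k) (⨆ k ∈ S t, m k) μ := by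
  have h := indep_iSup_of_disjoint hle hm (S := ⋃ s ∈ Set.Iio t, S s) (T := S t)
    (Set.disjoint_iUnion₂_left.2 fun s hs => hS (ne_of_lt hs))
  simpa only [Set.mem_Iio, iSup_iUnion] using h

/-! ### The empirical-Bernstein confidence sequence -/

theorem psiE_nonneg {l : ℝ} (h1 : l < 1) : 0 ≤ psiE l := by
  have := Real.log_le_sub_one_of_pos (sub_pos.2 h1)
  unfold psiE
  linarith

theorem measurable_psiE : Measurable psiE :=
  (Real.measurable_log.comp (measurable_const.sub measurable_id)).neg.sub measurable_id

theorem hasSum_neg_log_sub {z : ℝ} (hz : |z| < 1) :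
    HasSum (fun k : ℕ => z ^ (k + 2) / ((k : ℝ) + 2)) (-Real.log (1 - z) - z) := by
  have h := (hasSum_nat_add_iff' 1).2 (Real.hasSum_pow_div_log_of_abs_lt_one hz)
  rw [Finset.sum_range_one, Nat.cast_zero, zero_add, zero_add, pow_one, div_one] at h
  simpa only [Nat.cast_add, Nat.cast_one, add_assoc, one_add_one_eq_two] using h

/-- Fan's inequality. It is a termwise comparison of the power series of `-log (1 - z) - z` at
`z = -l y` and at `z = l`, as `(-y) ^ k ≤ y ^ 2` for `k ≥ 2`. -/
theorem exp_mul_sub_psiE_le {l y : ℝ} (h0 : 0 < l) (h1 : l < 1) (hy : |y| ≤ 1) :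
    Real.exp (l * y - psiE l * y ^ 2) ≤ 1 + l * y := by
  have hz : |-(l * y)| < 1 := by
    rw [abs_neg, abs_mul, abs_of_pos h0]
    nlinarith [abs_nonneg y]
  have hl : |l| < 1 := by rwa [abs_of_pos h0]
  have key : -Real.log (1 - -(l * y)) - -(l * y) ≤ y ^ 2 * psiE l := by
    refine hasSum_le (fun k => ?_) (hasSum_neg_log_sub hz) ((hasSum_neg_log_sub hl).mul_left _)
    have hk : (-y) ^ (k + 2) ≤ y ^ 2 := by
      have : (-y) ^ k ≤ 1 := (le_abs_self _).trans <| by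
        rw [abs_pow, abs_neg]; exact pow_le_one₀ (abs_nonneg y) hy
      calc (-y) ^ (k + 2) = (-y) ^ k * y ^ 2 := by ring
        _ ≤ 1 * y ^ 2 := by gcongr
        _ = y ^ 2 := one_mul _
    calc (-(l * y)) ^ (k + 2) / ((k : ℝ) + 2)
        = (-y) ^ (k + 2) * (l ^ (k + 2) / ((k : ℝ) + 2)) := by
          rw [← mul_div_assoc, ← mul_pow]; congr 2; ring
      _ ≤ y ^ 2 * (l ^ (k + 2) / ((k : ℝ) + 2)) := by gcongr
  have hpos : 0 < 1 + l * y := by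
    have := (abs_lt.1 hz).2
    linarith
  rw [← Real.le_log_iff_exp_le hpos]
  rw [sub_neg_eq_add, sub_neg_eq_add] at key
  linarith

/-- The multiplier of one round of the empirical-Bernstein process has mean at most `1`, for any
prediction `p` of the observation. -/
theorem lintegral_exp_psiE_le_one {Ω : Type*} {mΩ : MeasurableSpace Ω} {μ : Measure Ω}
    [IsProbabilityMeasure μ] {X : Ω → ℝ} (hX : Measurable X)
    (hX01 : ∀ ω, X ω ∈ Set.Icc (0 : ℝ) 1) {p m l : ℝ} (hp : p ∈ Set.Icc (0 : ℝ) 1)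
    (hm : ∫ ω, X ω ∂μ = m) (hl : l ∈ Set.Ioo (0 : ℝ) 1) :
    ∫⁻ ω, ENNReal.ofReal (Real.exp (l * (X ω - m) - psiE l * (X ω - p) ^ 2)) ∂μ ≤ 1 := by
  have hint : Integrable X μ := by
    refine Integrable.of_bound hX.aestronglyMeasurable 1 (ae_of_all _ fun ω => ?_)
    rw [Real.norm_eq_abs, abs_le]
    constructor <;> linarith [(hX01 ω).1, (hX01 ω).2]
  have habs : ∀ ω, |X ω - p| ≤ 1 := fun ω => by
    rw [abs_le]
    constructor <;> linarith [(hX01 ω).1, (hX01 ω).2, hp.1, hp.2]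
  have hlin : ∀ ω, 0 ≤ 1 + l * (X ω - p) := fun ω => by
    nlinarith [(abs_le.1 (habs ω)).1, hl.1, hl.2]
  have hsub : Integrable (fun ω => l * (X ω - p)) μ := (hint.sub (integrable_const p)).const_mul l
  have hint' : Integrable (fun ω => Real.exp (-(l * (m - p))) * (1 + l * (X ω - p))) μ :=
    ((integrable_const (1 : ℝ)).add hsub).const_mul _
  calc ∫⁻ ω, ENNReal.ofReal (Real.exp (l * (X ω - m) - psiE l * (X ω - p) ^ 2)) ∂μ
      ≤ ∫⁻ ω, ENNReal.ofReal (Real.exp (-(l * (m - p))) * (1 + l * (X ω - p))) ∂μ := by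
        refine lintegral_mono fun ω => ENNReal.ofReal_le_ofReal ?_
        have : l * (X ω - m) - psiE l * (X ω - p) ^ 2
            = -(l * (m - p)) + (l * (X ω - p) - psiE l * (X ω - p) ^ 2) := by ring
        rw [this, Real.exp_add]
        gcongr
        exact exp_mul_sub_psiE_le hl.1 hl.2 (habs ω)
    _ = ENNReal.ofReal (Real.exp (-(l * (m - p))) * (1 + l * (m - p))) := by
        rw [← ofReal_integral_eq_lintegral_ofReal hint'
          (ae_of_all _ fun ω => mul_nonneg (Real.exp_pos _).le (hlin ω)), integral_const_mul,
          integral_add (integrable_const _) hsub,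
          integral_const_mul, integral_sub hint (integrable_const p), hm]
        simp
    _ ≤ 1 := by
        rw [ENNReal.ofReal_le_one, Real.exp_neg, inv_mul_le_iff₀ (Real.exp_pos _), mul_one]
        linarith [Real.add_one_le_exp (l * (m - p))]

theorem integrableOn_exp_sub_psiE (q : Measure ℝ) [IsProbabilityMeasure q] {V : ℝ} (hV : 0 ≤ V)
    (S : ℝ) :
    IntegrableOn (fun l => Real.exp (l * S - psiE l * V)) (Set.Ioo 0 1) q := by
  refine Measure.integrableOn_of_bounded (M := Real.exp |S|) (measure_ne_top _ _)
    (Measurable.aestronglyMeasurable ?_) ?_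
  · exact ((measurable_id.mul_const S).sub (measurable_psiE.mul_const V)).exp
  · refine (ae_restrict_iff' measurableSet_Ioo).2 (ae_of_all _ fun l hl => ?_)
    rw [Real.norm_of_nonneg (Real.exp_pos _).le, Real.exp_le_exp]
    have h1 : l * S ≤ |S| := (le_abs_self _).trans <| by
      rw [abs_mul, abs_of_pos hl.1]; nlinarith [abs_nonneg S, hl.2]
    linarith [mul_nonneg (psiE_nonneg hl.2) hV]

/-- The supremum that defines the boundary is over a bounded set: as `x ≤ exp x`, the mixture is
at least `S` times a positive constant. -/
theorem bddAbove_mixtureBoundary (q : Measure ℝ) [IsProbabilityMeasure q]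
    (hq : q (Set.Ioo (0 : ℝ) 1)ᶜ = 0) (δ : ℝ) {V : ℝ} (hV : 0 ≤ V) :
    BddAbove {S : ℝ | ∫ l in Set.Ioo (0 : ℝ) 1, Real.exp (l * S - psiE l * V) ∂q < 1 / δ} := by
  set c := ∫ l in Set.Ioo (0 : ℝ) 1, l * Real.exp (-(psiE l * V)) ∂q with hc
  have hint : IntegrableOn (fun l => l * Real.exp (-(psiE l * V))) (Set.Ioo 0 1) q := by
    refine Integrable.mono' (integrableOn_exp_sub_psiE q hV 0)
      (Measurable.aestronglyMeasurable ?_) ?_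
    · exact measurable_id.mul (measurable_psiE.mul_const V).neg.exp
    · refine (ae_restrict_iff' measurableSet_Ioo).2 (ae_of_all _ fun l hl => ?_)
      rw [Real.norm_of_nonneg (mul_nonneg hl.1.le (Real.exp_pos _).le), mul_zero, zero_sub]
      exact mul_le_of_le_one_left (Real.exp_pos _).le hl.2.le
  have hcpos : 0 < c := by
    rw [hc, setIntegral_pos_iff_support_of_nonneg_ae _ hint]
    · have hsub : Set.Ioo (0 : ℝ) 1 ⊆
          (Function.support fun l => l * Real.exp (-(psiE l * V))) ∩ Set.Ioo 0 1 :=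
        fun l hl => ⟨(mul_pos hl.1 (Real.exp_pos _)).ne', hl⟩
      refine lt_of_lt_of_le ?_ (measure_mono hsub)
      rw [(prob_compl_eq_zero_iff measurableSet_Ioo).1 hq]
      exact zero_lt_one
    · exact (ae_restrict_iff' measurableSet_Ioo).2
        (ae_of_all _ fun l hl => mul_nonneg hl.1.le (Real.exp_pos _).le)
  refine ⟨1 / δ / c, fun S hS => ?_⟩
  rw [le_div_iff₀ hcpos]
  refine le_trans ?_ (show _ < 1 / δ from hS).le
  rw [hc, ← integral_const_mul]
  refine integral_mono (hint.const_mul S) (integrableOn_exp_sub_psiE q hV S) fun l => ?_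
  have h : l * S ≤ Real.exp (l * S) := by linarith [Real.add_one_le_exp (l * S)]
  calc S * (l * Real.exp (-(psiE l * V))) = (l * S) * Real.exp (-(psiE l * V)) := by ring
    _ ≤ Real.exp (l * S) * Real.exp (-(psiE l * V)) := by gcongr
    _ = Real.exp (l * S - psiE l * V) := by rw [← Real.exp_add, sub_eq_add_neg]

theorem le_mixture_of_mixtureBoundary_lt (q : Measure ℝ) [IsProbabilityMeasure q]
    (hq : q (Set.Ioo (0 : ℝ) 1)ᶜ = 0) {δ V S : ℝ} (hV : 0 ≤ V)
    (hS : mixtureBoundary q δ V < S) :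
    ENNReal.ofReal (1 / δ)
      ≤ ∫⁻ l in Set.Ioo (0 : ℝ) 1, ENNReal.ofReal (Real.exp (l * S - psiE l * V)) ∂q := by
  rw [← ofReal_integral_eq_lintegral_ofReal (integrableOn_exp_sub_psiE q hV S)
    (ae_of_all _ fun l => (Real.exp_pos _).le)]
  refine ENNReal.ofReal_le_ofReal (not_lt.1 fun h => ?_)
  exact absurd (le_csSup (bddAbove_mixtureBoundary q hq δ hV) h) (not_le.2 hS)

theorem measure_le_of_ofReal_mul_le_one {Ω : Type*} {mΩ : MeasurableSpace Ω} {μ : Measure Ω}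
    {δ : ℝ} (hδ : 0 < δ) {A : Set Ω} (h : ENNReal.ofReal (1 / δ) * μ A ≤ 1) :
    μ A ≤ ENNReal.ofReal δ := by
  rw [one_div, ENNReal.ofReal_inv_of_pos hδ] at h
  have h0 : ENNReal.ofReal δ ≠ 0 := by simpa using hδ
  calc μ A = ENNReal.ofReal δ * ((ENNReal.ofReal δ)⁻¹ * μ A) := by
        rw [← mul_assoc, ENNReal.mul_inv_cancel h0 ENNReal.ofReal_ne_top, one_mul]
    _ ≤ ENNReal.ofReal δ * 1 := by gcongr
    _ = ENNReal.ofReal δ := mul_one _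

/-- Time-uniform coverage of the mixture boundary. The observation of round `t` is `X t a b` when
the past is `a` and the new data are `b`; its mean given the past is `m t`, and `p t` predicts it
from the past. -/
theorem measure_mixtureBoundary_lt_le {Ω : Type*} {mΩ : MeasurableSpace Ω} {μ : Measure Ω}
    [IsProbabilityMeasure μ] {𝒢 : ℕ → MeasurableSpace Ω} (hle : ∀ t, 𝒢 t ≤ mΩ)
    (hind : ∀ t, Indep (⨆ s ∈ Set.Iio t, 𝒢 s) (𝒢 t) μ)
    (q : Measure ℝ) [IsProbabilityMeasure q] (hq : q (Set.Ioo (0 : ℝ) 1)ᶜ = 0)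
    {δ : ℝ} (hδ : 0 < δ) {X : ℕ → Ω → Ω → ℝ} {p : ℕ → Ω → ℝ} {m : ℕ → ℝ}
    (hX : ∀ t, 1 ≤ t →
      Measurable[(⨆ s ∈ Set.Iio t, 𝒢 s).prod (𝒢 t)] fun ab : Ω × Ω => X t ab.1 ab.2)
    (hX01 : ∀ t, 1 ≤ t → ∀ a b, X t a b ∈ Set.Icc (0 : ℝ) 1)
    (hXm : ∀ t, 1 ≤ t → ∀ a, ∫ b, X t a b ∂μ = m t)
    (hp : ∀ t, 1 ≤ t → Measurable[⨆ s ∈ Set.Iio t, 𝒢 s] (p t))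
    (hp01 : ∀ t, 1 ≤ t → ∀ a, p t a ∈ Set.Icc (0 : ℝ) 1) :
    μ {ω | ∃ t, 1 ≤ t ∧
        mixtureBoundary q δ (∑ s ∈ Finset.Icc 1 t, (X s ω ω - p s ω) ^ 2)
          < ∑ s ∈ Finset.Icc 1 t, (X s ω ω - m s)} ≤ ENNReal.ofReal δ := by
  set F : ℕ → ℝ → Ω → Ω → ℝ≥0∞ := fun t l a b => if t = 0 then 1 else
    ENNReal.ofReal (Real.exp (l * (X t a b - m t) - psiE l * (X t a b - p t a) ^ 2)) with hF
  have hprod : ∀ l ω t, ∏ s ∈ Finset.range (t + 1), F s l ω ω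
      = ENNReal.ofReal (Real.exp (l * ∑ s ∈ Finset.Icc 1 t, (X s ω ω - m s)
          - psiE l * ∑ s ∈ Finset.Icc 1 t, (X s ω ω - p s ω) ^ 2)) := by
    intro l ω t
    induction t with
    | zero => simp [hF]
    | succ t ih =>
      rw [Finset.prod_range_succ, ih, Finset.sum_Icc_succ_top (by omega),
        Finset.sum_Icc_succ_top (by omega)]
      simp only [hF, Nat.add_eq_zero_iff, one_ne_zero, and_false, if_false]
      rw [← ENNReal.ofReal_mul (Real.exp_pos _).le, ← Real.exp_add]
      congr 2
      ring
  have hcross := mixture_capital_crossing (q := q.restrict (Set.Ioo 0 1)) (μ := μ)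
    (by simpa using prob_le_one) hle hind (F := F) ?_ ?_ (ENNReal.ofReal (1 / δ))
  · refine (measure_mono ?_).trans (measure_le_of_ofReal_mul_le_one hδ hcross)
    rintro ω ⟨t, _, h⟩
    refine ⟨t + 1, ?_⟩
    simp only [hprod]
    exact le_mixture_of_mixtureBoundary_lt q hq (Finset.sum_nonneg fun s _ => sq_nonneg _) h
  · intro t
    rcases Nat.eq_zero_or_pos t with rfl | ht
    · simp only [hF, if_true]
      exact @measurable_const _ _ _ (_) _
    · simp only [hF, ht.ne', if_false]
      let m₁ : MeasurableSpace Ω := ⨆ s ∈ Set.Iio t, 𝒢 s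
      have hX' : Measurable[MeasurableSpace.prod inferInstance (m₁.prod (𝒢 t))]
          fun z : ℝ × Ω × Ω => X t z.2.1 z.2.2 :=
        (hX t ht).comp (@measurable_snd _ _ _ (m₁.prod (𝒢 t)))
      have hp' : Measurable[MeasurableSpace.prod inferInstance (m₁.prod (𝒢 t))]
          fun z : ℝ × Ω × Ω => p t z.2.1 :=
        (hp t ht).comp ((@measurable_fst _ _ m₁ (𝒢 t)).comp
          (@measurable_snd _ _ _ (m₁.prod (𝒢 t))))
      have hl' : Measurable[MeasurableSpace.prod inferInstance (m₁.prod (𝒢 t))]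
          fun z : ℝ × Ω × Ω => z.1 := @measurable_fst _ _ _ (m₁.prod (𝒢 t))
      exact ((hl'.mul (hX'.sub_const _)).sub
        ((measurable_psiE.comp hl').mul ((hX'.sub hp').pow_const 2))).exp.ennreal_ofReal
  · intro t
    refine (ae_restrict_iff' measurableSet_Ioo).2 (ae_of_all _ fun l hl a => ?_)
    rcases Nat.eq_zero_or_pos t with rfl | ht
    · simp [hF]
    · simp only [hF, ht.ne', if_false]
      have hXa : Measurable[𝒢 t] (X t a) :=
        (hX t ht).comp (@measurable_prodMk_left _ _ _ (_) a)
      exact lintegral_exp_psiE_le_one (hXa.mono (hle t) le_rfl) (hX01 t ht a) (hp01 t ht a)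
        (hXm t ht a) hl

/-! ### The betting confidence bound -/

theorem capital_eq_prod_range {bet : ℝ → (k : ℕ) → (Fin k → ℝ) → ℝ} {n : ℕ} (x : Fin n → ℝ)
    (m : ℝ) {i : ℕ} (hi : i ≤ n) :
    capital bet x m i = ∏ k ∈ Finset.range i, if h : k < n then
      1 - bet m k (fun j : Fin k => x (Fin.castLE h.le j)) * (x ⟨k, h⟩ - m) else 1 := by
  unfold capital
  refine Finset.prod_bij' (fun k _ => (k : ℕ))
    (fun k hk => ⟨k, (Finset.mem_range.1 hk).trans_le hi⟩) ?_ ?_ ?_ ?_ ?_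
  · intro k hk
    simpa using hk
  · intro k hk
    simpa using hk
  · intro k hk
    rfl
  · intro k hk
    rfl
  · intro k hk
    simp

/-- Coverage of the betting upper bound. The stakes against `m` may be unbounded (when `m = 1`),
hence the use of integrals with values in `[0, ∞]`. -/
theorem measure_bettingUpper_lt_mean_le {Ω : Type*} {mΩ : MeasurableSpace Ω} {μ : Measure Ω}
    [IsProbabilityMeasure μ] {𝒢 : ℕ → MeasurableSpace Ω} (hle : ∀ t, 𝒢 t ≤ mΩ)
    (hind : ∀ t, Indep (⨆ s ∈ Set.Iio t, 𝒢 s) (𝒢 t) μ)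
    {δ : ℝ} (hδ : 0 < δ) {bet : ℝ → (k : ℕ) → (Fin k → ℝ) → ℝ} (hbet : IsBettingStrategy bet)
    {n : ℕ} {x : Fin n → Ω → ℝ} (hx : ∀ i : Fin n, Measurable[𝒢 i] (x i))
    (hx01 : ∀ i ω, x i ω ∈ Set.Icc (0 : ℝ) 1) {m : ℝ} (hm : m ∈ Set.Icc (0 : ℝ) 1)
    (hxm : ∀ i, ∫ ω, x i ω ∂μ = m) :
    μ {ω | bettingUpper δ bet (fun i => x i ω) < m} ≤ ENNReal.ofReal δ := by
  set F : ℕ → Unit → Ω → Ω → ℝ≥0∞ := fun k _ a b => if h : k < n then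
    ENNReal.ofReal (1 - bet m k (fun j : Fin k => x (Fin.castLE h.le j) a) * (x ⟨k, h⟩ b - m))
    else 1 with hF
  have hnonneg : ∀ (k : ℕ) (h : k < n) v b, 0 ≤ 1 - bet m k v * (x ⟨k, h⟩ b - m) := by
    intro k h v b
    nlinarith [hbet.mul_le_one m hm k v, hbet.nonneg m hm k v, (hx01 ⟨k, h⟩ b).2]
  have hcross := mixture_capital_crossing (q := Measure.dirac ()) (μ := μ)
    (by simp) hle hind (F := F) ?_ ?_ (ENNReal.ofReal (1 / δ))
  · refine (measure_mono ?_).trans (measure_le_of_ofReal_mul_le_one hδ hcross)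
    intro ω hω
    have hex : ∃ i ≤ n, 1 / δ ≤ capital bet (fun i => x i ω) m i := by
      by_contra! hcon
      refine not_le.2 (show bettingUpper δ bet (fun i => x i ω) < m from hω) ?_
      exact le_csSup ⟨1, fun m' hm' => hm'.1.2⟩ ⟨hm, hcon⟩
    obtain ⟨i, hi, hcap⟩ := hex
    refine ⟨i, ?_⟩
    rw [capital_eq_prod_range _ _ hi] at hcap
    refine (ENNReal.ofReal_le_ofReal hcap).trans_eq ?_
    rw [lintegral_dirac, ENNReal.ofReal_prod_of_nonneg]
    · refine Finset.prod_congr rfl fun k _ => ?_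
      simp only [hF]
      split_ifs <;> simp
    · intro k _
      split_ifs with h
      · exact hnonneg k h _ ω
      · exact zero_le_one
  · intro k
    by_cases h : k < n
    · simp only [hF, h, dif_pos]
      let m₁ : MeasurableSpace Ω := ⨆ s ∈ Set.Iio k, 𝒢 s
      have ha : Measurable[MeasurableSpace.prod inferInstance (m₁.prod (𝒢 k))]
          fun z : Unit × Ω × Ω => z.2.1 :=
        (@measurable_fst _ _ m₁ (𝒢 k)).comp (@measurable_snd _ _ _ (m₁.prod (𝒢 k)))
      have hb : Measurable[MeasurableSpace.prod inferInstance (m₁.prod (𝒢 k)), 𝒢 k]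
          fun z : Unit × Ω × Ω => z.2.2 :=
        (@measurable_snd _ _ m₁ (𝒢 k)).comp (@measurable_snd _ _ _ (m₁.prod (𝒢 k)))
      have hhist : Measurable[m₁] fun a (j : Fin k) => x (Fin.castLE h.le j) a := by
        refine @measurable_pi_lambda _ _ _ m₁ _ _ fun j => ?_
        refine (hx (Fin.castLE h.le j)).mono ?_ le_rfl
        exact le_iSup₂_of_le (j : ℕ) j.isLt le_rfl
      exact (measurable_const.sub (((hbet.measurable m hm k).comp (hhist.comp ha)).mul
        (((hx ⟨k, h⟩).comp hb).sub_const m))).ennreal_ofReal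
    · simp only [hF, h, dif_neg, not_false_eq_true]
      exact @measurable_const _ _ _ (_) _
  · intro k
    refine ae_of_all _ fun _ a => ?_
    by_cases h : k < n
    · simp only [hF, h, dif_pos]
      have hxk : Measurable (x ⟨k, h⟩) := (hx ⟨k, h⟩).mono (hle _) le_rfl
      have hint : Integrable (x ⟨k, h⟩) μ := by
        refine Integrable.of_bound hxk.aestronglyMeasurable 1 (ae_of_all _ fun ω => ?_)
        rw [Real.norm_eq_abs, abs_le]
        constructor <;> linarith [(hx01 ⟨k, h⟩ ω).1, (hx01 ⟨k, h⟩ ω).2]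
      have hint' : Integrable (fun b => bet m k (fun j : Fin k => x (Fin.castLE h.le j) a)
          * (x ⟨k, h⟩ b - m)) μ := (hint.sub (integrable_const m)).const_mul _
      refine le_of_eq ?_
      have hint1 : Integrable (fun b => 1 - bet m k (fun j : Fin k => x (Fin.castLE h.le j) a)
          * (x ⟨k, h⟩ b - m)) μ := (integrable_const (1 : ℝ)).sub hint'
      rw [← ofReal_integral_eq_lintegral_ofReal hint1 (ae_of_all _ fun b => hnonneg k h _ b)]
      rw [integral_sub (integrable_const _) hint', integral_const_mul,
        integral_sub hint (integrable_const m), hxm]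
      simp
    · simp [hF, h]

/-! ### Range, measurability and mean of the prediction-powered estimates -/

section Estimates

variable {X Y O : Type*} {f : X → O} {loss : O → Y → ℝ} {fp : X → Y}

theorem normalize_mem_Icc {a x : ℝ} (ha : 0 ≤ a) (hx : x ∈ Set.Icc (-a) (1 + a)) :
    normalize a x ∈ Set.Icc (0 : ℝ) 1 := by
  have h : 0 < 1 + 2 * a := by linarith
  unfold normalize
  constructor
  · exact div_nonneg (by linarith [hx.1]) h.le
  · rw [div_le_one h]; linarith [hx.2]

theorem average_mem_Icc {n : ℕ} (hn : 0 < n) {v : Fin n → ℝ}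
    (hv : ∀ i, v i ∈ Set.Icc (0 : ℝ) 1) : 1 / n * ∑ i, v i ∈ Set.Icc (0 : ℝ) 1 := by
  refine ⟨mul_nonneg (by positivity) (Finset.sum_nonneg fun i _ => (hv i).1), ?_⟩
  have h : ∑ i, v i ≤ n := by
    simpa using Finset.sum_le_sum fun i (_ : i ∈ Finset.univ) => (hv i).2
  rw [one_div, inv_mul_le_iff₀ (by positivity), mul_one]
  exact h

theorem controlVariate_mem_Icc {a η s t r : ℝ} (hη : η ∈ Set.Icc 0 a)
    (hs : s ∈ Set.Icc (0 : ℝ) 1) (ht : t ∈ Set.Icc (0 : ℝ) 1) (hr : r ∈ Set.Icc (0 : ℝ) 1) :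
    η * s + r - η * t ∈ Set.Icc (-a) (1 + a) := by
  obtain ⟨hη0, hηa⟩ := hη
  constructor
  · nlinarith [mul_nonneg hη0 hs.1, mul_le_of_le_one_right hη0 ht.2, hr.1]
  · nlinarith [mul_nonneg hη0 ht.1, mul_le_of_le_one_right hη0 hs.2, hr.2]

theorem ppEstimate_mem_Icc (hloss01 : ∀ o y, loss o y ∈ Set.Icc (0 : ℝ) 1) {n N : ℕ} (hn : 0 < n)
    (hN : 0 < N) (D : Fin n → X × Y) (U : Fin N → X) {a η : ℝ} (hη : η ∈ Set.Icc 0 a) :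
    ppEstimate f loss fp D U η ∈ Set.Icc (-a) (1 + a) := by
  have h := controlVariate_mem_Icc hη
    (average_mem_Icc hN fun j => hloss01 (f (U j)) (fp (U j)))
    (average_mem_Icc hn fun i => hloss01 (f (D i).1) (fp (D i).1))
    (average_mem_Icc hn fun i => hloss01 (f (D i).1) (D i).2)
  convert h using 1
  simp only [ppEstimate, trueLoss, synthLoss]
  ring

theorem runningEstimate_mem_Icc {r₀ : ℝ} {e : ℕ → ℝ} {a b : ℝ} (hr₀ : r₀ ∈ Set.Icc a b)
    (he : ∀ s, 1 ≤ s → e s ∈ Set.Icc a b) (t : ℕ) : runningEstimate r₀ e t ∈ Set.Icc a b := by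
  unfold runningEstimate
  split_ifs with ht
  · exact hr₀
  · have ht' : (0 : ℝ) < t := by positivity
    have hcard : (Finset.Icc 1 t).card = t := by simp
    constructor
    · rw [le_div_iff₀ ht']
      have := Finset.card_nsmul_le_sum (Finset.Icc 1 t) e a
        fun s hs => (he s (Finset.mem_Icc.1 hs).1).1
      rw [hcard, nsmul_eq_mul] at this
      linarith
    · rw [div_le_iff₀ ht']
      have := Finset.sum_le_card_nsmul (Finset.Icc 1 t) e b
        fun s hs => (he s (Finset.mem_Icc.1 hs).1).2
      rw [hcard, nsmul_eq_mul] at this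
      linarith

theorem card_block {n N : ℕ} (hN : 0 < N) (hdvd : n ∣ N) (i : Fin n) :
    (Finset.univ.filter (fun j : Fin N => (j : ℕ) / (N / n) = (i : ℕ))).card = N / n := by
  have hb : 0 < N / n := Nat.div_pos (Nat.le_of_dvd hN hdvd) i.pos
  have hnb : n * (N / n) = N := Nat.mul_div_cancel' hdvd
  have himg : (Finset.univ.filter (fun j : Fin N => (j : ℕ) / (N / n) = (i : ℕ))).map
      Fin.valEmbedding = Finset.Ico (i * (N / n)) ((i + 1) * (N / n)) := by
    ext k
    simp only [Finset.mem_map, Finset.mem_filter, Finset.mem_univ, true_and,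
      Fin.valEmbedding_apply, Finset.mem_Ico]
    constructor
    · rintro ⟨j, hj, rfl⟩
      rw [Nat.div_eq_iff hb] at hj
      constructor
      · exact hj.1
      · have := hj.2
        rw [add_mul]
        omega
    · rintro ⟨h1, h2⟩
      have hkN : k < N := h2.trans_le <| by
        calc (i + 1) * (N / n) ≤ n * (N / n) := Nat.mul_le_mul_right _ i.isLt
          _ = N := hnb
      refine ⟨⟨k, hkN⟩, ?_, rfl⟩
      exact Nat.div_eq_of_lt_le h1 h2
  rw [← Finset.card_map Fin.valEmbedding, himg, Nat.card_Ico, ← Nat.sub_mul]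
  simp

/-- A block estimate is the prediction-powered estimate from one labeled sample and its block of
unlabeled inputs, enumerated in any order. -/
theorem exists_blockEstimate_eq_ppEstimate {n N : ℕ} (hN : 0 < N) (hdvd : n ∣ N) (η : ℝ)
    (i : Fin n) :
    ∃ u : Fin (N / n) → Fin N, (∀ j, (u j : ℕ) / (N / n) = i) ∧
      ∀ (D : Fin n → X × Y) (U : Fin N → X), blockEstimate f loss fp D U η i
        = ppEstimate f loss fp (fun _ : Fin 1 => D i) (fun j => U (u j)) η := by
  set B := Finset.univ.filter (fun j : Fin N => (j : ℕ) / (N / n) = (i : ℕ)) with hB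
  have e := B.equivFinOfCardEq (card_block hN hdvd i)
  refine ⟨fun j => (e.symm j : Fin N), fun j => (Finset.mem_filter.1 (e.symm j).2).2,
    fun D U => ?_⟩
  have hsum : ∑ j, synthLoss f loss fp (U (e.symm j : Fin N))
      = ∑ j ∈ B, synthLoss f loss fp (U j) := by
    rw [e.symm.sum_comp (fun j : B => synthLoss f loss fp (U j)),
      Finset.sum_coe_sort B fun j => synthLoss f loss fp (U j)]
  have hn : (n : ℝ) ≠ 0 := Nat.cast_ne_zero.2 i.pos.ne'
  have hN' : (N : ℝ) ≠ 0 := Nat.cast_ne_zero.2 hN.ne'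
  unfold blockEstimate ppEstimate
  rw [hsum, ← Finset.mul_sum, Nat.cast_div hdvd hn]
  simp only [Finset.univ_unique, Finset.sum_singleton, Nat.cast_one, div_one, one_mul]
  field_simp
  ring

variable [MeasurableSpace X] [MeasurableSpace Y] [MeasurableSpace O]

theorem measurable_trueLoss (hf : Measurable f) (hloss : Measurable (Function.uncurry loss)) :
    Measurable (trueLoss f loss) :=
  hloss.comp ((hf.comp measurable_fst).prodMk measurable_snd)

theorem measurable_synthLoss (hf : Measurable f) (hloss : Measurable (Function.uncurry loss))
    (hfp : Measurable fp) : Measurable (synthLoss f loss fp) :=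
  hloss.comp (hf.prodMk hfp)

theorem measurable_ppEstimate {α : Type*} [MeasurableSpace α] (hf : Measurable f)
    (hloss : Measurable (Function.uncurry loss)) (hfp : Measurable fp) {n N : ℕ}
    {D : Fin n → α → X × Y} {U : Fin N → α → X} {η : α → ℝ} (hD : ∀ i, Measurable (D i))
    (hU : ∀ j, Measurable (U j)) (hη : Measurable η) :
    Measurable fun a => ppEstimate f loss fp (fun i => D i a) (fun j => U j a) (η a) := by
  have ht := measurable_trueLoss hf hloss
  have hs := measurable_synthLoss hf hloss hfp
  have h1 : Measurable fun a => ∑ j, synthLoss f loss fp (U j a) :=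
    Finset.measurable_fun_sum _ fun j _ => hs.comp (hU j)
  have h2 : Measurable fun a => ∑ i, trueLoss f loss (D i a) :=
    Finset.measurable_fun_sum _ fun i _ => ht.comp (hD i)
  have h3 : Measurable fun a => ∑ i, synthLoss f loss fp (D i a).1 :=
    Finset.measurable_fun_sum _ fun i _ => hs.comp (measurable_fst.comp (hD i))
  exact ((hη.div_const _).mul h1).add ((h2.const_mul _).sub ((hη.div_const _).mul h3))

theorem measurable_normalize (a : ℝ) : Measurable (normalize a) :=
  (measurable_id.add_const a).div_const _

theorem integral_normalize {Ω : Type*} [MeasurableSpace Ω] {μ : Measure Ω}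
    [IsProbabilityMeasure μ] {Z : Ω → ℝ} (hZ : Integrable Z μ) (a : ℝ) :
    ∫ ω, normalize a (Z ω) ∂μ = normalize a (∫ ω, Z ω ∂μ) := by
  unfold normalize
  rw [integral_div, integral_add hZ (integrable_const a)]
  simp

theorem integrable_of_mem_Icc {Ω : Type*} [MeasurableSpace Ω] {μ : Measure Ω}
    [IsFiniteMeasure μ] {Z : Ω → ℝ} (hZ : Measurable Z) {a b : ℝ}
    (h : ∀ ω, Z ω ∈ Set.Icc a b) : Integrable Z μ :=
  Integrable.of_mem_Icc a b hZ.aemeasurable (ae_of_all _ h)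

theorem risk_mem_Icc {Q : Measure (X × Y)} [IsProbabilityMeasure Q] (hf : Measurable f)
    (hloss : Measurable (Function.uncurry loss)) (hloss01 : ∀ o y, loss o y ∈ Set.Icc (0 : ℝ) 1) :
    risk f loss Q ∈ Set.Icc (0 : ℝ) 1 := by
  refine ⟨integral_nonneg fun z => (hloss01 _ _).1, ?_⟩
  have hint : Integrable (trueLoss f loss) Q :=
    integrable_of_mem_Icc (measurable_trueLoss hf hloss) fun z => hloss01 _ _
  simpa [risk] using integral_mono hint (integrable_const (1 : ℝ)) fun z => (hloss01 _ _).2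

section Mean

variable {Ω : Type*} [MeasurableSpace Ω] {μ : Measure Ω} [IsProbabilityMeasure μ]
  {Q : Measure (X × Y)} {n N : ℕ} {D : Fin n → Ω → X × Y} {U : Fin N → Ω → X}

/-- The prediction-powered estimate is unbiased for every fixed reliance weight: the synthetic
losses of labeled and of unlabeled inputs have the same mean. -/
theorem integral_ppEstimate (hf : Measurable f) (hloss : Measurable (Function.uncurry loss))
    (hloss01 : ∀ o y, loss o y ∈ Set.Icc (0 : ℝ) 1) (hfp : Measurable fp) (hn : 0 < n)
    (hN : 0 < N) (hD : ∀ i, Measurable (D i)) (hU : ∀ j, Measurable (U j))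
    (hDlaw : ∀ i, μ.map (D i) = Q) (hUlaw : ∀ j, μ.map (U j) = Q.map Prod.fst) (η : ℝ) :
    ∫ ω, ppEstimate f loss fp (fun i => D i ω) (fun j => U j ω) η ∂μ = risk f loss Q := by
  have ht := measurable_trueLoss hf hloss
  have hs := measurable_synthLoss hf hloss hfp
  have hR : ∀ i, ∫ ω, trueLoss f loss (D i ω) ∂μ = risk f loss Q := fun i => by
    rw [risk, ← hDlaw i, integral_map (hD i).aemeasurable ht.aestronglyMeasurable]
  have hSD : ∀ i, ∫ ω, synthLoss f loss fp (D i ω).1 ∂μ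
      = ∫ x, synthLoss f loss fp x ∂(Q.map Prod.fst) := fun i => by
    rw [← hDlaw i, Measure.map_map measurable_fst (hD i),
      integral_map (measurable_fst.comp (hD i)).aemeasurable hs.aestronglyMeasurable]
    rfl
  have hSU : ∀ j, ∫ ω, synthLoss f loss fp (U j ω) ∂μ
      = ∫ x, synthLoss f loss fp x ∂(Q.map Prod.fst) := fun j => by
    rw [← hUlaw j, integral_map (hU j).aemeasurable hs.aestronglyMeasurable]
  have hiR : ∀ i, Integrable (fun ω => trueLoss f loss (D i ω)) μ := fun i =>
    integrable_of_mem_Icc (ht.comp (hD i)) fun ω => hloss01 _ _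
  have hiD : ∀ i, Integrable (fun ω => synthLoss f loss fp (D i ω).1) μ := fun i =>
    integrable_of_mem_Icc (hs.comp (measurable_fst.comp (hD i))) fun ω => hloss01 _ _
  have hiU : ∀ j, Integrable (fun ω => synthLoss f loss fp (U j ω)) μ := fun j =>
    integrable_of_mem_Icc (hs.comp (hU j)) fun ω => hloss01 _ _
  have h1 : Integrable (fun ω => η / N * ∑ j, synthLoss f loss fp (U j ω)) μ :=
    (integrable_finsetSum _ fun j _ => hiU j).const_mul _
  have h2 : Integrable (fun ω => 1 / (n : ℝ) * ∑ i, trueLoss f loss (D i ω)) μ :=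
    (integrable_finsetSum _ fun i _ => hiR i).const_mul _
  have h3 : Integrable (fun ω => η / n * ∑ i, synthLoss f loss fp (D i ω).1) μ :=
    (integrable_finsetSum _ fun i _ => hiD i).const_mul _
  have h23 : Integrable (fun ω => 1 / (n : ℝ) * ∑ i, trueLoss f loss (D i ω)
      - η / n * ∑ i, synthLoss f loss fp (D i ω).1) μ := h2.sub h3
  have hn' : (n : ℝ) ≠ 0 := Nat.cast_ne_zero.2 hn.ne'
  have hN' : (N : ℝ) ≠ 0 := Nat.cast_ne_zero.2 hN.ne'
  unfold ppEstimate
  rw [integral_add h1 h23, integral_sub h2 h3, integral_const_mul, integral_const_mul,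
    integral_const_mul, integral_finsetSum _ fun j _ => hiU j,
    integral_finsetSum _ fun i _ => hiR i, integral_finsetSum _ fun i _ => hiD i]
  simp only [hR, hSD, hSU, Finset.sum_const, Finset.card_univ, Fintype.card_fin, nsmul_eq_mul]
  field_simp
  ring

end Mean

end Estimates

/-! ### Coverage of the source and test bounds -/

section Coverage

variable {Ω X Y O : Type*} [MeasurableSpace X] [MeasurableSpace Y]
  {f : X → O} {loss : O → Y → ℝ} {fp : X → Y} {P : ℕ → Measure (X × Y)} {n N : ℕ → ℕ}
  {D : (t : ℕ) → Fin (n t) → Ω → X × Y} {U : (t : ℕ) → Fin (N t) → Ω → X}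

/-- The σ-algebra generated by a single sample of the stream, labeled or unlabeled. -/
abbrev sampleSigma (D : (t : ℕ) → Fin (n t) → Ω → X × Y) (U : (t : ℕ) → Fin (N t) → Ω → X)
    (k : Σ t : ℕ, Fin (n t) ⊕ Fin (N t)) : MeasurableSpace Ω :=
  Sum.elim (fun i => MeasurableSpace.comap (D k.1 i) inferInstance)
    (fun j => MeasurableSpace.comap (U k.1 j) inferInstance) k.2

theorem measurable_labeled_biSup {S : Set (Σ t : ℕ, Fin (n t) ⊕ Fin (N t))} {t : ℕ}
    {i : Fin (n t)} (h : ⟨t, .inl i⟩ ∈ S) :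
    Measurable[⨆ k ∈ S, sampleSigma D U k] (D t i) :=
  measurable_iff_comap_le.2 <| le_iSup₂_of_le (f := fun k (_ : k ∈ S) => sampleSigma D U k)
    ⟨t, .inl i⟩ h le_rfl

theorem measurable_unlabeled_biSup {S : Set (Σ t : ℕ, Fin (n t) ⊕ Fin (N t))} {t : ℕ}
    {j : Fin (N t)} (h : ⟨t, .inr j⟩ ∈ S) :
    Measurable[⨆ k ∈ S, sampleSigma D U k] (U t j) :=
  measurable_iff_comap_le.2 <| le_iSup₂_of_le (f := fun k (_ : k ∈ S) => sampleSigma D U k)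
    ⟨t, .inr j⟩ h le_rfl

variable [MeasurableSpace Ω] {μ : Measure Ω}

theorem IsDataStream.sampleSigma_le (hdata : IsDataStream μ P D U)
    (k : Σ t : ℕ, Fin (n t) ⊕ Fin (N t)) : sampleSigma D U k ≤ ‹MeasurableSpace Ω› := by
  obtain ⟨t, i | j⟩ := k
  · exact (hdata.measurable_labeled t i).comap_le
  · exact (hdata.measurable_unlabeled t j).comap_le

variable [MeasurableSpace O] [IsProbabilityMeasure μ]

/-- Coverage of the source bound. Round `k` of the betting game uses the labeled sample `k` and
the `k`-th block of unlabeled inputs. -/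
theorem measure_sourceUpper_lt_risk_le (hf : Measurable f)
    (hloss : Measurable (Function.uncurry loss))
    (hloss01 : ∀ o y, loss o y ∈ Set.Icc (0 : ℝ) 1) (hfp : Measurable fp)
    [IsProbabilityMeasure (P 0)] (hN : 0 < N 0) (hblocks : n 0 ∣ N 0)
    (hdata : IsDataStream μ P D U) {δ : ℝ} (hδ : 0 < δ) {η₀ : ℝ} (hη₀ : 0 ≤ η₀)
    {bet : ℝ → (k : ℕ) → (Fin k → ℝ) → ℝ} (hbet : IsBettingStrategy bet) :
    μ {ω | sourceUpper f loss fp δ bet (fun i => D 0 i ω) (fun j => U 0 j ω) η₀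
        < risk f loss (P 0)} ≤ ENNReal.ofReal δ := by
  have hb : 0 < N 0 / n 0 :=
    Nat.div_pos (Nat.le_of_dvd hN hblocks) (Nat.pos_of_dvd_of_pos hblocks hN)
  set S : ℕ → Set (Σ t : ℕ, Fin (n t) ⊕ Fin (N t)) := fun k =>
    {z | z.1 = 0 ∧ Sum.elim (fun i : Fin (n z.1) => (i : ℕ))
      (fun j : Fin (N z.1) => (j : ℕ) / (N z.1 / n z.1)) z.2 = k} with hSdef
  have hS : Pairwise fun s t => Disjoint (S s) (S t) := fun s t hst =>
    Set.disjoint_left.2 fun z hz hz' => hst (hz.2.symm.trans hz'.2)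
  set 𝒢 : ℕ → MeasurableSpace Ω := fun t => ⨆ k ∈ S t, sampleSigma D U k with h𝒢
  have hle : ∀ t, 𝒢 t ≤ ‹MeasurableSpace Ω› := fun t =>
    iSup₂_le fun k _ => hdata.sampleSigma_le k
  have hind := indep_biSup_Iio hdata.sampleSigma_le hdata.indep hS
  choose u hu hpp using fun i : Fin (n 0) =>
    exists_blockEstimate_eq_ppEstimate (f := f) (loss := loss) (fp := fp) hN hblocks η₀ i
  set x : Fin (n 0) → Ω → ℝ := fun i ω =>
    normalize η₀ (blockEstimate f loss fp (fun i => D 0 i ω) (fun j => U 0 j ω) η₀ i) with hx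
  have hx' : ∀ i, x i = fun ω => normalize η₀ (ppEstimate f loss fp
      (fun _ : Fin 1 => D 0 i ω) (fun j => U 0 (u i j) ω) η₀) := fun i => by
    ext ω
    simp only [hx, hpp]
  have hxmeas : ∀ i : Fin (n 0), Measurable[𝒢 i] (x i) := fun i => by
    rw [hx']
    let m₁ : MeasurableSpace Ω := 𝒢 i
    refine (measurable_normalize η₀).comp
      (measurable_ppEstimate hf hloss hfp (fun _ => ?_) (fun j => ?_) measurable_const)
    · exact measurable_labeled_biSup (by simp [hSdef])
    · exact measurable_unlabeled_biSup (by simp [hSdef, hu])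
  have hmem : ∀ i ω, ppEstimate f loss fp (fun _ : Fin 1 => D 0 i ω)
      (fun j => U 0 (u i j) ω) η₀ ∈ Set.Icc (-η₀) (1 + η₀) := fun i ω =>
    ppEstimate_mem_Icc hloss01 one_pos hb _ _ ⟨hη₀, le_rfl⟩
  have hxmean : ∀ i, ∫ ω, x i ω ∂μ = normalize η₀ (risk f loss (P 0)) := fun i => by
    have hmeas := measurable_ppEstimate hf hloss hfp (η := fun _ => η₀)
      (fun _ : Fin 1 => hdata.measurable_labeled 0 i)
      (fun j => hdata.measurable_unlabeled 0 (u i j)) measurable_const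
    simp only [hx']
    rw [integral_normalize (integrable_of_mem_Icc hmeas (hmem i)),
      integral_ppEstimate hf hloss hloss01 hfp one_pos hb
        (fun _ => hdata.measurable_labeled 0 i) (fun _ => hdata.measurable_unlabeled 0 _)
        (fun _ => hdata.law_labeled 0 i) (fun _ => hdata.law_unlabeled 0 _)]
  have hR := risk_mem_Icc (Q := P 0) hf hloss hloss01
  refine (measure_mono fun ω hω => ?_).trans
    (measure_bettingUpper_lt_mean_le hle hind hδ hbet (x := x) hxmeas
      (fun i ω => by rw [hx']; exact normalize_mem_Icc hη₀ (hmem i ω))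
      (normalize_mem_Icc hη₀ ⟨by linarith [hR.1], by linarith [hR.2]⟩) hxmean)
  have hω' : (1 + 2 * η₀) * bettingUpper δ bet (fun i => x i ω) - η₀ < risk f loss (P 0) := hω
  show bettingUpper δ bet (fun i => x i ω) < (risk f loss (P 0) + η₀) / (1 + 2 * η₀)
  rw [lt_div_iff₀ (by linarith)]
  linarith

/-- Time-uniform coverage of the test bound. The past of time `t` includes the source data, on
which the prediction used at time `1` may depend. -/
theorem measure_runningRisk_lt_testLower_le (hf : Measurable f)
    (hloss : Measurable (Function.uncurry loss))
    (hloss01 : ∀ o y, loss o y ∈ Set.Icc (0 : ℝ) 1) (hfp : Measurable fp)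
    (hn : ∀ t, 0 < n t) (hN : ∀ t, 0 < N t)
    (hdata : IsDataStream μ P D U) {δ : ℝ} (hδ : 0 < δ)
    {ηmax : ℝ} {η : ℕ → Ω → ℝ} (hη : ∀ t, 1 ≤ t → ∀ ω, η t ω ∈ Set.Icc 0 ηmax)
    (hηpred : ∀ t, 1 ≤ t → Measurable[pastSigma D U t] (η t))
    (q : Measure ℝ) [IsProbabilityMeasure q] (hq : q (Set.Ioo (0 : ℝ) 1)ᶜ = 0)
    {r₀ : Ω → ℝ} (hr₀ : Measurable[batchSigma D U 0] r₀)
    (hr₀range : ∀ ω, r₀ ω ∈ Set.Icc (-ηmax) (1 + ηmax)) :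
    μ {ω | ∃ t, 1 ≤ t ∧ runningRisk f loss P t < testLower ηmax q δ (r₀ ω)
        (fun s => ppEstimate f loss fp (fun i => D s i ω) (fun j => U s j ω) (η s ω)) t}
      ≤ ENNReal.ofReal δ := by
  obtain ⟨ω₀⟩ : Nonempty Ω := nonempty_of_isProbabilityMeasure μ
  have hηmax : 0 ≤ ηmax := (hη 1 le_rfl ω₀).1.trans (hη 1 le_rfl ω₀).2
  set S : ℕ → Set (Σ t : ℕ, Fin (n t) ⊕ Fin (N t)) := fun t => {z | z.1 = t} with hSdef
  have hS : Pairwise fun s t => Disjoint (S s) (S t) := fun s t hst =>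
    Set.disjoint_left.2 fun z hz hz' => hst (Eq.trans (Eq.symm hz) hz')
  set 𝒢 : ℕ → MeasurableSpace Ω := fun t => ⨆ k ∈ S t, sampleSigma D U k with h𝒢
  have hle : ∀ t, 𝒢 t ≤ ‹MeasurableSpace Ω› := fun t =>
    iSup₂_le fun k _ => hdata.sampleSigma_le k
  have hind := indep_biSup_Iio hdata.sampleSigma_le hdata.indep hS
  have hDm : ∀ t i, Measurable[𝒢 t] (D t i) := fun t i =>
    measurable_labeled_biSup (show _ ∈ S t from rfl)
  have hUm : ∀ t j, Measurable[𝒢 t] (U t j) := fun t j =>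
    measurable_unlabeled_biSup (show _ ∈ S t from rfl)
  have hbatch : ∀ t, batchSigma D U t ≤ 𝒢 t := fun t =>
    sup_le (iSup_le fun i => measurable_iff_comap_le.1 (hDm t i))
      (iSup_le fun j => measurable_iff_comap_le.1 (hUm t j))
  set ℱ : ℕ → MeasurableSpace Ω := fun t => ⨆ s ∈ Set.Iio t, 𝒢 s with hℱ
  have h𝒢ℱ : ∀ s t, s < t → 𝒢 s ≤ ℱ t := fun s t h => le_iSup₂_of_le s h le_rfl
  have hpast : ∀ t, pastSigma D U t ≤ ℱ t := fun t =>
    iSup₂_le fun s hs => (hbatch s).trans (h𝒢ℱ s t (Finset.mem_Ico.1 hs).2)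
  have hmono : Monotone ℱ := fun s t hst =>
    biSup_mono fun r (hr : r < s) => lt_of_lt_of_le hr hst
  have hηm : ∀ t, 1 ≤ t → Measurable[ℱ t] (η t) := fun t ht =>
    (hηpred t ht).mono (hpast t) le_rfl
  set e : Ω → ℕ → ℝ := fun ω s =>
    ppEstimate f loss fp (fun i => D s i ω) (fun j => U s j ω) (η s ω) with he
  have hemem : ∀ s, 1 ≤ s → ∀ a b, ppEstimate f loss fp (fun i => D s i b) (fun j => U s j b)
      (η s a) ∈ Set.Icc (-ηmax) (1 + ηmax) := fun s hs a b =>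
    ppEstimate_mem_Icc hloss01 (hn s) (hN s) _ _ (hη s hs a)
  have hem : ∀ s t, 1 ≤ s → s < t → Measurable[ℱ t] fun ω => e ω s := fun s t hs hst => by
    let m₁ : MeasurableSpace Ω := ℱ t
    exact measurable_ppEstimate hf hloss hfp
      (fun i => (hDm s i).mono (h𝒢ℱ s t hst) le_rfl)
      (fun j => (hUm s j).mono (h𝒢ℱ s t hst) le_rfl) ((hηm s hs).mono (hmono hst.le) le_rfl)
  have hcross := measure_mixtureBoundary_lt_le (μ := μ) hle hind q hq hδ
    (X := fun t a b => normalize ηmax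
      (ppEstimate f loss fp (fun i => D t i b) (fun j => U t j b) (η t a)))
    (p := fun t a => normalize ηmax (runningEstimate (r₀ a) (e a) (t - 1)))
    (m := fun t => normalize ηmax (risk f loss (P t))) ?_ ?_ ?_ ?_ ?_
  · refine (measure_mono ?_).trans hcross
    rintro ω ⟨t, ht, h⟩
    refine ⟨t, ht, ?_⟩
    have ht' : (0 : ℝ) < t := by exact_mod_cast ht
    have hpos : 0 < 1 + 2 * ηmax := by linarith
    have hsum : ∑ s ∈ Finset.Icc 1 t,
        (normalize ηmax (e ω s) - normalize ηmax (risk f loss (P s)))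
        = (∑ s ∈ Finset.Icc 1 t, e ω s - ∑ s ∈ Finset.Icc 1 t, risk f loss (P s))
          / (1 + 2 * ηmax) := by
      rw [← Finset.sum_sub_distrib, Finset.sum_div]
      refine Finset.sum_congr rfl fun s _ => ?_
      unfold normalize
      rw [← sub_div]
      congr 1
      ring
    show mixtureBoundary q δ (predictionError ηmax (r₀ ω) (e ω) t) < ∑ s ∈ Finset.Icc 1 t,
        (normalize ηmax (e ω s) - normalize ηmax (risk f loss (P s)))
    rw [hsum, lt_div_iff₀ hpos]
    change runningRisk f loss P t < testLower ηmax q δ (r₀ ω) (e ω) t at h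
    rw [testLower, runningRisk, runningEstimate, if_neg (by omega), ← mul_div_assoc, ← sub_div,
      div_lt_div_iff_of_pos_right ht'] at h
    linarith
  · intro t ht
    let m₁ : MeasurableSpace Ω := ℱ t
    have hb : Measurable[m₁.prod (𝒢 t), 𝒢 t] fun z : Ω × Ω => z.2 := @measurable_snd _ _ m₁ (𝒢 t)
    have ha : Measurable[m₁.prod (𝒢 t), m₁] fun z : Ω × Ω => z.1 := @measurable_fst _ _ m₁ (𝒢 t)
    refine (measurable_normalize ηmax).comp ?_
    exact @measurable_ppEstimate X Y O f loss fp _ _ _ (Ω × Ω) (m₁.prod (𝒢 t)) hf hloss hfp _ _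
      (fun i z => D t i z.2) (fun j z => U t j z.2) (fun z => η t z.1)
      (fun i => (hDm t i).comp hb) (fun j => (hUm t j).comp hb) ((hηm t ht).comp ha)
  · intro t ht a b
    exact normalize_mem_Icc hηmax (hemem t ht a b)
  · intro t ht a
    have hmeas := measurable_ppEstimate hf hloss hfp (η := fun _ => η t a)
      (hdata.measurable_labeled t) (hdata.measurable_unlabeled t) measurable_const
    rw [integral_normalize (integrable_of_mem_Icc hmeas (hemem t ht a)),
      integral_ppEstimate hf hloss hloss01 hfp (hn t) (hN t) (hdata.measurable_labeled t)
        (hdata.measurable_unlabeled t) (hdata.law_labeled t) (hdata.law_unlabeled t)]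
  · intro t ht
    let m₁ : MeasurableSpace Ω := ℱ t
    refine (measurable_normalize ηmax).comp ?_
    unfold runningEstimate
    split_ifs with h0
    · exact hr₀.mono ((hbatch 0).trans (h𝒢ℱ 0 t ht)) le_rfl
    · refine (Finset.measurable_fun_sum _ fun s hs => ?_).div_const _
      have hs' := Finset.mem_Icc.1 hs
      exact hem s t hs'.1 (by omega)
  · intro t ht a
    exact normalize_mem_Icc hηmax
      (runningEstimate_mem_Icc (hr₀range a) (fun s hs => hemem s hs a a) _)

end Coverage

end PPRM

theorem theorem1
    {Ω X Y O : Type*} [MeasurableSpace Ω] [MeasurableSpace X] [MeasurableSpace Y]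
    [MeasurableSpace O] (μ : Measure Ω) [IsProbabilityMeasure μ]
    -- the deployed model, the loss with values in `[0,1]`, and the synthetic labels
    (f : X → O) (hf : Measurable f)
    (loss : O → Y → ℝ) (hloss : Measurable (Function.uncurry loss))
    (hloss01 : ∀ o y, loss o y ∈ Set.Icc (0 : ℝ) 1)
    (fp : X → Y) (hfp : Measurable fp)
    -- the distributions, the batch sizes and the data
    (P : ℕ → Measure (X × Y)) [∀ t, IsProbabilityMeasure (P t)]
    (n N : ℕ → ℕ) (hn : ∀ t, 0 < n t) (hN : ∀ t, 0 < N t) (hblocks : n 0 ∣ N 0)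
    (D : (t : ℕ) → Fin (n t) → Ω → X × Y) (U : (t : ℕ) → Fin (N t) → Ω → X)
    (hdata : PPRM.IsDataStream μ P D U)
    -- miscoverage levels and tolerance
    (δS δT tol : ℝ) (hδS : δS ∈ Set.Ioo (0 : ℝ) 1) (hδT : δT ∈ Set.Ioo (0 : ℝ) 1)
    (hδ : δS + δT ∈ Set.Ioo (0 : ℝ) 1) (htol : 0 < tol)
    -- source reliance weight and betting strategy
    (η₀ : ℝ) (hη₀ : 0 ≤ η₀)
    (bet : ℝ → (k : ℕ) → (Fin k → ℝ) → ℝ) (hbet : PPRM.IsBettingStrategy bet)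
    -- predictable test reliance weights
    (ηmax : ℝ) (η : ℕ → Ω → ℝ)
    (hη : ∀ t, 1 ≤ t → ∀ ω, η t ω ∈ Set.Icc 0 ηmax)
    (hηpred : ∀ t, 1 ≤ t → Measurable[PPRM.pastSigma D U t] (η t))
    -- mixing distribution on `(0,1)`
    (q : Measure ℝ) [IsProbabilityMeasure q] (hq : q (Set.Ioo (0 : ℝ) 1)ᶜ = 0)
    -- the prediction used at time `1`, a function of the source data
    (r₀ : Ω → ℝ) (hr₀ : Measurable[PPRM.batchSigma D U 0] r₀)
    (hr₀range : ∀ ω, r₀ ω ∈ Set.Icc (-ηmax) (1 + ηmax))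
    -- the null hypothesis
    (hnull : PPRM.NullHypothesis f loss P tol) :
    μ {ω | ∃ t : ℕ, 1 ≤ t ∧
        PPRM.alarm f loss fp D U δS δT tol η₀ bet ηmax η q r₀ t ω = 1}
      ≤ ENNReal.ofReal (δS + δT) := by

  refine (measure_mono (t := {ω | PPRM.sourceUpper f loss fp δS bet (fun i => D 0 i ω)
        (fun j => U 0 j ω) η₀ < PPRM.risk f loss (P 0)}
      ∪ {ω | ∃ t, 1 ≤ t ∧ PPRM.runningRisk f loss P t < PPRM.testLower ηmax q δT (r₀ ω)
        (fun s => PPRM.ppEstimate f loss fp (fun i => D s i ω) (fun j => U s j ω) (η s ω)) t})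
    ?_).trans ((measure_union_le _ _).trans ?_)
  · rintro ω ⟨t, ht, h⟩
    by_cases hS : PPRM.sourceUpper f loss fp δS bet (fun i => D 0 i ω) (fun j => U 0 j ω) η₀
        < PPRM.risk f loss (P 0)
    · exact Or.inl hS
    · refine Or.inr ⟨t, ht, ?_⟩
      unfold PPRM.alarm at h
      split_ifs at h with hL
      linarith [hnull t ht]
  · rw [ENNReal.ofReal_add hδS.1.le hδT.1.le]
    exact add_le_add
      (PPRM.measure_sourceUpper_lt_risk_le hf hloss hloss01 hfp (hN 0) hblocks hdata hδS.1 hη₀ hbet)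
      (PPRM.measure_runningRisk_lt_testLower_le hf hloss hloss01 hfp hn hN hdata hδT.1 hη hηpred
        q hq hr₀ hr₀range)
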